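/- For $A\subset\mathbb{R}^m$ let $\dim_H A$ denote its Hausdorff dimension and $\dim_p A$ its (classical) packing dimension. That is, for $s\ge 0$ and $\delta>0$ let $P^s_\delta(A)$ be the supremum of $\sum_i (2r_i)^s$ over all countable families of pairwise disjoint closed balls with centres in $A$ and radii $r_i\in(0,\delta]$, put $P^s_0(A)=\lim_{\delta\to 0}P^s_\delta(A)$ and $\mathcal{P}^s(A)=\inf\{\sum_{n} P^s_0(A_n) : A\subset\bigcup_{n} A_n\}$ (countable covers), and let $\dim_p A=\sup\{s\ge 0:\mathcal{P}^s(A)=\infty\}$, with $\sup\emptyset=0$. For $S\subset\mathbb{R}^3$ let $S_{1}=\{s_1 : (s_1,s_2,s_3)\in S\}\subset\mathbb{R}$, $S_{12}=\{(s_1,s_2) : (s_1,s_2,s_3)\in S\}\subset\mathbb{R}^2$ and $S_{13}=\{(s_1,s_3) : (s_1,s_2,s_3)\in S\}\subset\mathbb{R}^2$ be its projections onto the indicated coordinates. Proposition. Let $S\subset\mathbb{R}^3$ be an arbitrary set, and let $a,b\ge 0$ be two real numbers such that \[ \dim_p S_{12}+\dim_p S_{13}\le a+b . \] Then there exist sets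 $S',S''\subset\mathbb{R}^3$ with $S=S'\cup S''$ such that \[ \dim_H(S'_1)\le a\quad\text{and}\quad \dim_H(S'')\le b , \] where $S'_1$ is the projection of $S'$ onto the first coordinate. -/

import Mathlib

open scoped ENNReal NNReal

/-- `P` is a finite `δ`-packing of `A`: each `p ∈ P` encodes the closed ball with centre `p.1 ∈ A`
and radius `p.2 ∈ (0, δ]`, and these balls are pairwise disjoint. -/
def IsBallPacking {X : Type*} [MetricSpace X] (δ : ℝ) (A : Set X) (P : Finset (X × ℝ)) : Prop :=
  (∀ p ∈ P, p.1 ∈ A ∧ 0 < p.2 ∧ p.2 ≤ δ) ∧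
    (P : Set (X × ℝ)).PairwiseDisjoint (fun p => Metric.closedBall p.1 p.2)

/-- `P^s_δ(A)`: the supremum of `∑ (2 rᵢ) ^ s` over all `δ`-packings of `A` by balls of radii `rᵢ`.
Finite packings suffice, since a sum of nonnegative terms is the supremum of its finite subsums. -/
noncomputable def packingSum {X : Type*} [MetricSpace X] (s : ℝ≥0) (δ : ℝ) (A : Set X) : ℝ≥0∞ :=
  ⨆ (P : Finset (X × ℝ)) (_ : IsBallPacking δ A P), ∑ p ∈ P, ENNReal.ofReal (2 * p.2) ^ (s : ℝ)

/-- The `s`-dimensional packing premeasure `P^s_0(A) = lim_{δ → 0} P^s_δ(A)`; the limit is the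
infimum because `P^s_δ(A)` is monotone in `δ`. -/
noncomputable def packingPremeasure {X : Type*} [MetricSpace X] (s : ℝ≥0) (A : Set X) : ℝ≥0∞ :=
  ⨅ (δ : ℝ) (_ : 0 < δ), packingSum s δ A

/-- The `s`-dimensional packing measure of `A`: the infimum of `∑ P^s_0(Tₙ)` over all countable
covers `T₀, T₁, …` of `A`. -/
noncomputable def packingMeasure {X : Type*} [MetricSpace X] (s : ℝ≥0) (A : Set X) : ℝ≥0∞ :=
  ⨅ (T : ℕ → Set X) (_ : A ⊆ ⋃ n, T n), ∑' n, packingPremeasure s (T n)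

/-- The packing dimension of `A`: the supremum of the `s ≥ 0` with infinite `s`-dimensional packing
measure (compare `dimH` and `dimH_def` for the Hausdorff dimension). -/
noncomputable def packingDim {X : Type*} [MetricSpace X] (A : Set X) : ℝ≥0∞ :=
  ⨆ (s : ℝ≥0) (_ : packingMeasure s A = ∞), (s : ℝ≥0∞)

/-- The projection of a subset of `ℝ³` to the `i`-th coordinate (coordinates are `0`, `1`, `2`). -/
def proj₁ (i : Fin 3) (S : Set (EuclideanSpace ℝ (Fin 3))) : Set ℝ :=
  (fun x => x i) '' S

/-- The projection of a subset of `ℝ³` to the coordinates `i` and `j`. -/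
def proj₂ (i j : Fin 3) (S : Set (EuclideanSpace ℝ (Fin 3))) : Set (EuclideanSpace ℝ (Fin 2)) :=
  (fun x => !₂[x i, x j]) '' S

open MeasureTheory Filter Topology Set

/-! At scale `2 ^ (-k)`, a packing bound limits the number of dyadic squares met. After a countable
splitting, `S₁₂` and `S₁₃` meet `O(2 ^ (k * p))` and `O(2 ^ (k * q))` squares, with `p`, `q`
slightly above their packing dimensions. Call a dyadic interval of the first axis heavy if more than
`2 ^ (k * (q - a))` squares of `S₁₃` lie over it. There are `O(2 ^ (k * a))` heavy intervals, and
`O(2 ^ (k * (p + q - a)))` cubes suffice over the light ones (`exists_light_heavy`). Let `S'` hold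
the points whose first coordinate is heavy at infinitely many scales; points of `S''` are light from
some scale on. Both dimension bounds come from `dimH_le_of_frequently_mem`. Countable stability of
`dimH` reassembles the pieces. -/

/-! ### Hausdorff dimension of limsup sets. -/

/-- A set is covered infinitely often by families of at most `C * 2 ^ (k * t)` sets of diameter
at most `c * 2 ^ (-k)`; then its Hausdorff dimension is at most `t`. -/
theorem dimH_le_of_frequently_mem {X ι : Type*} [MetricSpace X] {A : Set X}
    (D : ℕ → ι → Set X) (Q : ℕ → Finset ι) {c C t : ℝ} (hc : 0 < c) (hC : 0 ≤ C) (ht : 0 ≤ t)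
    (k₀ : ℕ) (hD : ∀ k i, ∀ x ∈ D k i, ∀ y ∈ D k i, dist x y ≤ c * (2⁻¹ : ℝ) ^ k)
    (hQ : ∀ k, k₀ ≤ k → ((Q k).card : ℝ) ≤ C * ((2 : ℝ) ^ t) ^ k)
    (hA : ∀ x ∈ A, ∃ᶠ k in atTop, ∃ i ∈ Q k, x ∈ D k i) :
    dimH A ≤ ENNReal.ofReal t := by
  borelize X
  refine le_of_forall_gt fun s' hs' => ?_
  obtain ⟨s, hts, hss'⟩ := ENNReal.lt_iff_exists_nnreal_btwn.1 hs'
  refine lt_of_le_of_lt (dimH_le_of_hausdorffMeasure_ne_top ?_) hss'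
  have hts : t < s := by
    rw [ENNReal.ofReal_lt_iff_lt_toReal ht (by simp)] at hts
    simpa using hts
  set ρ : ℝ := 2 ^ (t - s) with hρ
  have hρ0 : 0 ≤ ρ := by positivity
  have hρ1 : ρ < 1 := Real.rpow_lt_one_of_one_lt_of_neg (by norm_num) (by linarith)
  set B : ℝ := C * c ^ (s : ℝ) with hB
  have hediam : ∀ k i, Metric.ediam (D k i) ≤ ENNReal.ofReal (c * (2⁻¹ : ℝ) ^ k) := by
    intro k i
    refine Metric.ediam_le fun x hx y hy => ?_
    rw [edist_dist]
    exact ENNReal.ofReal_le_ofReal (hD k i x hx y hy)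
  have hlevel : ∀ k, k₀ ≤ k →
      ∑ i ∈ Q k, Metric.ediam (D k i) ^ (s : ℝ) ≤ ENNReal.ofReal (B * ρ ^ k) := by
    intro k hk
    calc ∑ i ∈ Q k, Metric.ediam (D k i) ^ (s : ℝ)
        ≤ ∑ i ∈ Q k, ENNReal.ofReal ((c * (2⁻¹ : ℝ) ^ k) ^ (s : ℝ)) := by
          refine Finset.sum_le_sum fun i _ => ?_
          rw [← ENNReal.ofReal_rpow_of_nonneg (by positivity) s.coe_nonneg]
          exact ENNReal.rpow_le_rpow (hediam k i) s.coe_nonneg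
      _ = ENNReal.ofReal ((Q k).card * (c * (2⁻¹ : ℝ) ^ k) ^ (s : ℝ)) := by
          rw [Finset.sum_const, nsmul_eq_mul, ENNReal.ofReal_mul (by positivity),
            ENNReal.ofReal_natCast]
      _ ≤ ENNReal.ofReal (B * ρ ^ k) := by
          refine ENNReal.ofReal_le_ofReal ?_
          refine (mul_le_mul_of_nonneg_right (hQ k hk) (by positivity)).trans_eq ?_
          have h2 : ((2⁻¹ : ℝ) ^ k) ^ (s : ℝ) = ((2 : ℝ) ^ (-(s : ℝ))) ^ k := by
            rw [← Real.rpow_natCast, ← Real.rpow_natCast, ← Real.rpow_mul (by norm_num),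
              ← Real.rpow_mul (by norm_num), ← Real.rpow_neg_one, ← Real.rpow_mul (by norm_num)]
            congr 1
            ring
          rw [Real.mul_rpow hc.le (by positivity), h2, hB, hρ, sub_eq_add_neg,
            Real.rpow_add (by norm_num), mul_pow]
          ring
  -- For every `n` the pieces of all levels `≥ n` cover `A`. Their `s`-sums are dominated by a
  -- geometric series of ratio `ρ < 1`, because `s > t`.
  have key := Measure.hausdorffMeasure_le_liminf_tsum (X := X) (s : ℝ) A (l := atTop)
    (ι := fun n : ℕ => Σ k : ℕ, Q (n + k)) (fun n => ENNReal.ofReal (c * (2⁻¹ : ℝ) ^ n))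
    (by
      have : Tendsto (fun n : ℕ => c * (2⁻¹ : ℝ) ^ n) atTop (𝓝 (c * 0)) :=
        (tendsto_pow_atTop_nhds_zero_of_lt_one (by norm_num) (by norm_num)).const_mul c
      simpa using ENNReal.tendsto_ofReal this)
    (fun n p => D (n + p.1) p.2)
    (Eventually.of_forall fun n p => (hediam _ _).trans <| ENNReal.ofReal_le_ofReal <|
      mul_le_mul_of_nonneg_left
        (pow_le_pow_of_le_one (by norm_num) (by norm_num) (Nat.le_add_right _ _)) hc.le)
    (Eventually.of_forall fun n x hx => by
      obtain ⟨k, hk, i, hi, hxi⟩ := frequently_atTop.1 (hA x hx) n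
      obtain ⟨m, rfl⟩ := Nat.exists_eq_add_of_le hk
      exact mem_iUnion.2 ⟨⟨m, i, hi⟩, hxi⟩)
  refine ne_top_of_le_ne_top ?_ (key.trans (liminf_le_of_le (by isBoundedDefault)
    (a := ENNReal.ofReal (∑' k : ℕ, B * ρ ^ k)) ?_))
  · exact ENNReal.ofReal_ne_top
  intro b hb
  obtain ⟨n, hn, hbn⟩ := (hb.and (eventually_ge_atTop k₀)).exists
  refine hn.trans ?_
  have hsum : Summable fun k : ℕ => B * ρ ^ k :=
    (summable_geometric_of_lt_one hρ0 hρ1).mul_left B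
  have hB0 : 0 ≤ B := by positivity
  rw [ENNReal.ofReal_tsum_of_nonneg (fun k => by positivity) hsum, ENNReal.tsum_sigma']
  refine ENNReal.tsum_le_tsum fun k => ?_
  rw [tsum_fintype]
  simp only
  rw [Finset.sum_coe_sort (Q (n + k)) (fun i => Metric.ediam (D (n + k) i) ^ (s : ℝ))]
  refine (hlevel (n + k) (by omega)).trans (ENNReal.ofReal_le_ofReal ?_)
  exact mul_le_mul_of_nonneg_left
    (pow_le_pow_of_le_one hρ0 hρ1.le (Nat.le_add_left _ _)) hB0

/-! ### Counting dyadic squares by packings. -/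

/-- The index of the dyadic interval of length `2 ^ (-k)` that contains `x`. -/
noncomputable def dyadicIndex (k : ℕ) (x : ℝ) : ℤ := ⌊2 ^ k * x⌋

theorem dist_le_of_dyadicIndex_eq {k : ℕ} {x y : ℝ} (h : dyadicIndex k x = dyadicIndex k y) :
    |x - y| ≤ (2⁻¹ : ℝ) ^ k := by
  have h1 := (Int.abs_sub_lt_one_of_floor_eq_floor h).le
  rw [← mul_sub, abs_mul, abs_of_pos (by positivity)] at h1
  rw [inv_pow, ← one_div, le_div_iff₀ (by positivity)]
  linarith

/-- Distinct indices of equal parity differ by at least 2, so a whole dyadic interval separates the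
two points. -/
theorem lt_dist_of_dyadicIndex {k : ℕ} {x y : ℝ} (h : dyadicIndex k x ≠ dyadicIndex k y)
    (h2 : (dyadicIndex k x : ZMod 2) = dyadicIndex k y) : (2⁻¹ : ℝ) ^ k < |x - y| := by
  have h3 := (ZMod.intCast_eq_intCast_iff_dvd_sub _ _ 2).1 h2
  suffices 1 < |2 ^ k * x - 2 ^ k * y| by
    rw [← mul_sub, abs_mul, abs_of_pos (by positivity)] at this
    rw [inv_pow, ← one_div, div_lt_iff₀ (by positivity)]
    linarith
  unfold dyadicIndex at *
  set u := (2 : ℝ) ^ k * x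
  set v := (2 : ℝ) ^ k * y
  have hu := Int.floor_le u
  have hu' := Int.lt_floor_add_one u
  have hv := Int.floor_le v
  have hv' := Int.lt_floor_add_one v
  rcases lt_or_gt_of_ne h with h | h
  · have : ⌊u⌋ + 2 ≤ ⌊v⌋ := by push_cast at h3; omega
    have : (⌊u⌋ : ℝ) + 2 ≤ ⌊v⌋ := by exact_mod_cast this
    rw [lt_abs]; right; linarith
  · have : ⌊v⌋ + 2 ≤ ⌊u⌋ := by push_cast at h3; omega
    have : (⌊v⌋ : ℝ) + 2 ≤ ⌊u⌋ := by exact_mod_cast this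
    rw [lt_abs]; left; linarith

/-- The index of the dyadic square of side `2 ^ (-k)` that contains `x`. -/
noncomputable def dyadicSquare (k : ℕ) (x : EuclideanSpace ℝ (Fin 2)) : ℤ × ℤ :=
  (dyadicIndex k (x 0), dyadicIndex k (x 1))

theorem EuclideanSpace.abs_sub_apply_le_dist {n : ℕ} (x y : EuclideanSpace ℝ (Fin n))
    (i : Fin n) : |x i - y i| ≤ dist x y := by
  simpa [dist_eq_norm] using PiLp.norm_apply_le (x - y) i

/-- Within one parity class, points chosen in distinct squares are more than `2 ^ (-k)` apart, so
the balls of radius `2 ^ (-k) / 2` about them form a packing. -/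
theorem card_mul_le_packingSum {s : ℝ≥0} {δ : ℝ} {T : Set (EuclideanSpace ℝ (Fin 2))} {k : ℕ}
    (hk : (2⁻¹ : ℝ) ^ k ≤ δ) (F : Finset (ℤ × ℤ)) (hF : (F : Set (ℤ × ℤ)) ⊆ dyadicSquare k '' T)
    (z : ZMod 2 × ZMod 2) (hz : ∀ f ∈ F, ((f.1 : ZMod 2), (f.2 : ZMod 2)) = z) :
    F.card * ENNReal.ofReal ((2⁻¹ : ℝ) ^ k) ^ (s : ℝ) ≤ packingSum s δ T := by
  classical
  have hpos : (0 : ℝ) < (2⁻¹ : ℝ) ^ k := by positivity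
  choose! x hxT hx using fun f (hf : f ∈ F) => hF hf
  have hinj : Set.InjOn (fun f => (x f, (2⁻¹ : ℝ) ^ k / 2)) F := by
    intro f hf g hg h
    rw [← hx f hf, ← hx g hg, (Prod.mk.inj h).1]
  have hP : IsBallPacking δ T (F.image fun f => (x f, (2⁻¹ : ℝ) ^ k / 2)) := by
    constructor
    · intro p hp
      obtain ⟨f, hf, rfl⟩ := Finset.mem_image.1 hp
      exact ⟨hxT f hf, by positivity, by simp only; linarith⟩
    · intro p hp q hq hpq
      obtain ⟨f, hf, rfl⟩ := Finset.mem_image.1 (Finset.mem_coe.1 hp)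
      obtain ⟨g, hg, rfl⟩ := Finset.mem_image.1 (Finset.mem_coe.1 hq)
      refine Metric.closedBall_disjoint_closedBall ?_
      simp only [add_halves]
      have hfg : f ≠ g := fun h => hpq (by rw [h])
      have h2 := (hz f hf).trans (hz g hg).symm
      rw [Prod.mk.injEq, ← hx f hf, ← hx g hg] at h2
      rw [← hx f hf, ← hx g hg, Ne, Prod.ext_iff, not_and_or] at hfg
      rcases hfg with h | h
      · exact (lt_dist_of_dyadicIndex h h2.1).trans_le
          (EuclideanSpace.abs_sub_apply_le_dist _ _ _)
      · exact (lt_dist_of_dyadicIndex h h2.2).trans_le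
          (EuclideanSpace.abs_sub_apply_le_dist _ _ _)
  refine le_trans (le_of_eq ?_) (le_iSup₂ (f := fun (P : Finset (EuclideanSpace ℝ (Fin 2) × ℝ))
    (_ : IsBallPacking δ T P) => ∑ p ∈ P, ENNReal.ofReal (2 * p.2) ^ (s : ℝ)) _ hP)
  rw [Finset.sum_image hinj]
  simp [mul_div_cancel₀]

/-- The number of dyadic squares of side `2 ^ (-k)` that meet `T` is `O(2 ^ (k * s))`. -/
def HasBoxBound (s : ℝ) (T : Set (EuclideanSpace ℝ (Fin 2))) : Prop :=
  ∃ (C : ℝ) (k₀ : ℕ), 0 ≤ C ∧ ∀ k, k₀ ≤ k → ∃ E : Finset (ℤ × ℤ),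
    (∀ x ∈ T, dyadicSquare k x ∈ E) ∧ (E.card : ℝ) ≤ C * ((2 : ℝ) ^ s) ^ k

theorem HasBoxBound.of_packingSum_ne_top {s : ℝ≥0} {δ : ℝ} (hδ : 0 < δ)
    {T : Set (EuclideanSpace ℝ (Fin 2))} (hT : packingSum s δ T ≠ ∞) : HasBoxBound s T := by
  classical
  set M := (packingSum s δ T).toReal with hM
  obtain ⟨k₀, hk₀⟩ := exists_pow_lt_of_lt_one hδ (by norm_num : (2⁻¹ : ℝ) < 1)
  -- The factor 4 is the number of parity classes of squares.
  refine ⟨4 * M, k₀, by positivity, fun k hk => ?_⟩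
  have hkδ : (2⁻¹ : ℝ) ^ k ≤ δ :=
    (pow_le_pow_of_le_one (by norm_num) (by norm_num) hk).trans hk₀.le
  have hcl : ∀ (F : Finset (ℤ × ℤ)), (F : Set (ℤ × ℤ)) ⊆ dyadicSquare k '' T →
      ∀ z : ZMod 2 × ZMod 2, (∀ f ∈ F, ((f.1 : ZMod 2), (f.2 : ZMod 2)) = z) →
      (F.card : ℝ) ≤ M * ((2 : ℝ) ^ (s : ℝ)) ^ k := by
    intro F hF z hz
    have h := ENNReal.toReal_mono hT (card_mul_le_packingSum (s := s) hkδ F hF z hz)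
    rw [ENNReal.toReal_mul, ENNReal.toReal_natCast, ← ENNReal.toReal_rpow,
      ENNReal.toReal_ofReal (by positivity), ← hM] at h
    have h2 : ((2⁻¹ : ℝ) ^ k) ^ (s : ℝ) * ((2 : ℝ) ^ (s : ℝ)) ^ k = 1 := by
      rw [← Real.rpow_natCast, ← Real.rpow_natCast, ← Real.rpow_mul (by norm_num),
        ← Real.rpow_mul (by norm_num), mul_comm (s : ℝ), ← Real.mul_rpow (by norm_num)
        (by norm_num)]
      norm_num
    calc (F.card : ℝ) = F.card * ((2⁻¹ : ℝ) ^ k) ^ (s : ℝ) * ((2 : ℝ) ^ (s : ℝ)) ^ k := by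
          rw [mul_assoc, h2, mul_one]
      _ ≤ _ := mul_le_mul_of_nonneg_right h (by positivity)
  have hfin : ∀ F : Finset (ℤ × ℤ), (F : Set (ℤ × ℤ)) ⊆ dyadicSquare k '' T →
      (F.card : ℝ) ≤ 4 * M * ((2 : ℝ) ^ (s : ℝ)) ^ k := by
    intro F hF
    have hcard := Finset.card_eq_sum_card_fiberwise (s := F)
      (f := fun f : ℤ × ℤ => ((f.1 : ZMod 2), (f.2 : ZMod 2))) (t := Finset.univ)
      (fun _ _ => Finset.mem_coe.2 (Finset.mem_univ _))
    rw [hcard, Nat.cast_sum]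
    refine (Finset.sum_le_card_nsmul _ _ (M * ((2 : ℝ) ^ (s : ℝ)) ^ k) fun z _ => ?_).trans_eq ?_
    · exact hcl _ (fun f hf => hF (Finset.mem_filter.1 hf).1) z
        fun f hf => (Finset.mem_filter.1 hf).2
    · simp
      ring
  have hfinite : (dyadicSquare k '' T).Finite := by
    by_contra hinf
    obtain ⟨n, hn⟩ := exists_nat_gt (4 * M * ((2 : ℝ) ^ (s : ℝ)) ^ k)
    obtain ⟨F, hF, rfl⟩ := Set.Infinite.exists_subset_card_eq hinf n
    exact (hfin F hF).not_gt hn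
  exact ⟨hfinite.toFinset, fun x hx => hfinite.mem_toFinset.2 ⟨x, hx, rfl⟩,
    hfin _ (by simp)⟩

theorem exists_cover_hasBoxBound {s : ℝ≥0} {A : Set (EuclideanSpace ℝ (Fin 2))}
    (h : packingDim A < s) :
    ∃ T : ℕ → Set (EuclideanSpace ℝ (Fin 2)), A ⊆ ⋃ n, T n ∧ ∀ n, HasBoxBound s (T n) := by
  have hs : packingMeasure s A ≠ ∞ := fun h' =>
    h.not_ge (le_iSup₂ (f := fun (s : ℝ≥0) (_ : packingMeasure s A = ∞) => (s : ℝ≥0∞)) s h')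
  have hlt : packingMeasure s A < ∞ := lt_top_iff_ne_top.2 hs
  simp only [packingMeasure, iInf_lt_iff] at hlt
  obtain ⟨T, hAT, hT⟩ := hlt
  refine ⟨T, hAT, fun n => ?_⟩
  have hn := (ENNReal.le_tsum n).trans_lt hT
  simp only [packingPremeasure, iInf_lt_iff] at hn
  obtain ⟨δ, hδ, hn⟩ := hn
  exact HasBoxBound.of_packingSum_ne_top hδ hn.ne

/-! ### Splitting into heavy and light columns. -/

theorem EuclideanSpace.dist_le_sum_three (x y : EuclideanSpace ℝ (Fin 3)) :
    dist x y ≤ |x 0 - y 0| + |x 1 - y 1| + |x 2 - y 2| := by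
  rw [EuclideanSpace.dist_eq, Fin.sum_univ_three]
  refine Real.sqrt_le_iff.2 ⟨by positivity, ?_⟩
  simp only [Real.dist_eq]
  nlinarith [mul_nonneg (abs_nonneg (x 0 - y 0)) (abs_nonneg (x 1 - y 1)),
    mul_nonneg (abs_nonneg (x 0 - y 0)) (abs_nonneg (x 2 - y 2)),
    mul_nonneg (abs_nonneg (x 1 - y 1)) (abs_nonneg (x 2 - y 2))]

/-- Given finite sets `E`, `F` of pairs, either the first coordinate of a compatible triple lies in a
set of at most `#F / M` values, or the triple lies in a set of at most `#E * M` triples. -/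
theorem exists_light_heavy (E F : Finset (ℤ × ℤ)) {M : ℝ} (hM : 0 < M) :
    ∃ (L : Finset ℤ) (G : Finset (ℤ × ℤ × ℤ)),
      (L.card : ℝ) * M ≤ F.card ∧ (G.card : ℝ) ≤ E.card * M ∧
      ∀ i j l, (i, j) ∈ E → (i, l) ∈ F → i ∉ L → (i, j, l) ∈ G := by
  classical
  set N : ℤ → Finset (ℤ × ℤ) := fun i => F.filter fun f => f.1 = i with hN
  -- `L` consists of the columns holding more than `M` elements of `F`; over any other column each
  -- pair in `E` extends to at most `M` triples.
  refine ⟨(F.image Prod.fst).filter fun i => M < (N i).card,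
    (E.filter fun e => ((N e.1).card : ℝ) ≤ M).biUnion fun e =>
      (N e.1).image fun f => (e.1, e.2, f.2), ?_, ?_, ?_⟩
  · have h := Finset.card_eq_sum_card_fiberwise (s := F) (f := Prod.fst) (t := F.image Prod.fst)
      (fun f hf => Finset.mem_coe.2 (Finset.mem_image_of_mem _ hf))
    rw [h, Nat.cast_sum, ← nsmul_eq_mul]
    refine le_trans (Finset.card_nsmul_le_sum _ (fun i => ((N i).card : ℝ)) _
      fun i hi => (Finset.mem_filter.1 hi).2.le) ?_
    exact Finset.sum_le_sum_of_subset_of_nonneg (Finset.filter_subset _ _)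
      fun _ _ _ => Nat.cast_nonneg _
  · calc _ ≤ ∑ e ∈ E.filter fun e => ((N e.1).card : ℝ) ≤ M, ((N e.1).card : ℝ) := by
          refine (Nat.cast_le.2 Finset.card_biUnion_le).trans ?_
          rw [Nat.cast_sum]
          exact Finset.sum_le_sum fun e _ => Nat.cast_le.2 Finset.card_image_le
      _ ≤ (E.filter fun e => ((N e.1).card : ℝ) ≤ M).card * M := by
          rw [← nsmul_eq_mul]
          exact Finset.sum_le_card_nsmul _ _ _ fun e he => (Finset.mem_filter.1 he).2
      _ ≤ E.card * M := mul_le_mul_of_nonneg_right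
          (Nat.cast_le.2 (Finset.card_le_card (Finset.filter_subset _ _))) hM.le
  · intro i j l hE hF hL
    have hi : ((N i).card : ℝ) ≤ M := by
      by_contra h
      exact hL (Finset.mem_filter.2 ⟨Finset.mem_image.2 ⟨_, hF, rfl⟩, not_le.1 h⟩)
    exact Finset.mem_biUnion.2 ⟨(i, j), Finset.mem_filter.2 ⟨hE, hi⟩,
      Finset.mem_image.2 ⟨(i, l), Finset.mem_filter.2 ⟨hF, rfl⟩, rfl⟩⟩

theorem exists_decomposition_of_hasBoxBound {S : Set (EuclideanSpace ℝ (Fin 3))} {p q a b : ℝ}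
    (ha : 0 ≤ a) (hb : 0 ≤ b) (hpq : p + q ≤ a + b)
    (h₁ : HasBoxBound p (proj₂ 0 1 S)) (h₂ : HasBoxBound q (proj₂ 0 2 S)) :
    ∃ S' S'' : Set (EuclideanSpace ℝ (Fin 3)), S = S' ∪ S'' ∧
      dimH (proj₁ 0 S') ≤ ENNReal.ofReal a ∧ dimH S'' ≤ ENNReal.ofReal b := by
  obtain ⟨C, k₁, hC, hE⟩ := h₁
  obtain ⟨C', k₂, hC', hF⟩ := h₂
  choose! E hES hEC using hE
  choose! F hFS hFC using hF
  -- This threshold turns `#F / M` into `O(2 ^ (k * a))`; then `#E * M` is `O(2 ^ (k * b))` because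
  -- `p + q - a ≤ b`.
  choose L G hL hG hLG using fun k : ℕ =>
    exists_light_heavy (E k) (F k) (M := ((2 : ℝ) ^ (q - a)) ^ k) (by positivity)
  have hLC : ∀ k, max k₁ k₂ ≤ k → ((L k).card : ℝ) ≤ C' * ((2 : ℝ) ^ a) ^ k := by
    intro k hk
    have h := (hL k).trans (hFC k ((le_max_right _ _).trans hk))
    have hq : ((2 : ℝ) ^ q) ^ k = ((2 : ℝ) ^ a) ^ k * ((2 : ℝ) ^ (q - a)) ^ k := by
      rw [← mul_pow, ← Real.rpow_add (by norm_num), add_sub_cancel]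
    rw [hq, ← mul_assoc] at h
    exact le_of_mul_le_mul_right h (by positivity)
  have hGC : ∀ k, max k₁ k₂ ≤ k → ((G k).card : ℝ) ≤ C * ((2 : ℝ) ^ b) ^ k := by
    intro k hk
    refine (hG k).trans ((mul_le_mul_of_nonneg_right (hEC k ((le_max_left _ _).trans hk))
      (by positivity)).trans ?_)
    rw [mul_assoc, ← mul_pow, ← Real.rpow_add (by norm_num)]
    gcongr
    · norm_num
    · linarith
  refine ⟨{x ∈ S | ∃ᶠ k in atTop, dyadicIndex k (x 0) ∈ L k},
    {x ∈ S | ¬ ∃ᶠ k in atTop, dyadicIndex k (x 0) ∈ L k}, ?_, ?_, ?_⟩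
  · ext x
    simp only [mem_union, mem_ofPred_eq]
    tauto
  · refine dimH_le_of_frequently_mem (fun k i => {x : ℝ | dyadicIndex k x = i}) L one_pos hC' ha
      (max k₁ k₂) ?_ hLC ?_
    · intro k i x hx y hy
      rw [one_mul, Real.dist_eq]
      exact dist_le_of_dyadicIndex_eq (hx.trans hy.symm)
    · rintro _ ⟨x, hx, rfl⟩
      exact hx.2.mono fun k hk => ⟨_, hk, rfl⟩
  · refine dimH_le_of_frequently_mem (fun k i => {x : EuclideanSpace ℝ (Fin 3) |
      (dyadicIndex k (x 0), dyadicIndex k (x 1), dyadicIndex k (x 2)) = i}) G three_pos hC hb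
      (max k₁ k₂) ?_ hGC ?_
    · intro k i x hx y hy
      have h := hx.trans hy.symm
      simp only [Prod.mk.injEq] at h
      have h0 := dist_le_of_dyadicIndex_eq h.1
      have h1 := dist_le_of_dyadicIndex_eq h.2.1
      have h2 := dist_le_of_dyadicIndex_eq h.2.2
      linarith [EuclideanSpace.dist_le_sum_three x y]
    · rintro x ⟨hxS, hx⟩
      refine Eventually.frequently ?_
      filter_upwards [not_frequently.1 hx, eventually_ge_atTop (max k₁ k₂)] with k hk hk'
      refine ⟨_, hLG k _ _ _ ?_ ?_ hk, rfl⟩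
      · simpa [dyadicSquare] using hES k ((le_max_left _ _).trans hk') _ ⟨x, hxS, rfl⟩
      · simpa [dyadicSquare] using hFS k ((le_max_right _ _).trans hk') _ ⟨x, hxS, rfl⟩

/-! ### From box counts to packing dimension. -/

theorem HasBoxBound.mono {s : ℝ} {T T' : Set (EuclideanSpace ℝ (Fin 2))} (h : HasBoxBound s T')
    (hT : T ⊆ T') : HasBoxBound s T := by
  obtain ⟨C, k₀, hC, hE⟩ := h
  refine ⟨C, k₀, hC, fun k hk => ?_⟩
  obtain ⟨E, hE, hc⟩ := hE k hk
  exact ⟨E, fun x hx => hE x (hT hx), hc⟩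

theorem exists_decomposition_of_packingDim_lt {S : Set (EuclideanSpace ℝ (Fin 3))} {p q : ℝ≥0}
    {a b : ℝ} (ha : 0 ≤ a) (hb : 0 ≤ b) (hpq : (p : ℝ) + q ≤ a + b)
    (h₁ : packingDim (proj₂ 0 1 S) < p) (h₂ : packingDim (proj₂ 0 2 S) < q) :
    ∃ S' S'' : Set (EuclideanSpace ℝ (Fin 3)), S = S' ∪ S'' ∧
      dimH (proj₁ 0 S') ≤ ENNReal.ofReal a ∧ dimH S'' ≤ ENNReal.ofReal b := by
  obtain ⟨T, hST, hT⟩ := exists_cover_hasBoxBound h₁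
  obtain ⟨U, hSU, hU⟩ := exists_cover_hasBoxBound h₂
  set V : ℕ × ℕ → Set (EuclideanSpace ℝ (Fin 3)) := fun n =>
    {x ∈ S | !₂[x 0, x 1] ∈ T n.1 ∧ !₂[x 0, x 2] ∈ U n.2}
  have hV : ∀ n, ∃ S' S'' : Set (EuclideanSpace ℝ (Fin 3)), V n = S' ∪ S'' ∧
      dimH (proj₁ 0 S') ≤ ENNReal.ofReal a ∧ dimH S'' ≤ ENNReal.ofReal b := fun n =>
    exists_decomposition_of_hasBoxBound ha hb hpq
      ((hT n.1).mono (by rintro _ ⟨x, hx, rfl⟩; exact hx.2.1))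
      ((hU n.2).mono (by rintro _ ⟨x, hx, rfl⟩; exact hx.2.2))
  choose S' S'' hS ha' hb' using hV
  refine ⟨⋃ n, S' n, ⋃ n, S'' n, ?_, ?_, ?_⟩
  · rw [← iUnion_union_distrib, ← iUnion_congr hS]
    refine Subset.antisymm (fun x hx => ?_) (iUnion_subset fun n x hx => hx.1)
    obtain ⟨m, hm⟩ := mem_iUnion.1 (hST ⟨x, hx, rfl⟩)
    obtain ⟨n, hn⟩ := mem_iUnion.1 (hSU ⟨x, hx, rfl⟩)
    exact mem_iUnion.2 ⟨(m, n), hx, hm, hn⟩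
  · rw [proj₁, image_iUnion, dimH_iUnion]
    exact iSup_le ha'
  · rw [dimH_iUnion]
    exact iSup_le hb'

theorem mainTheorem3 (S : Set (EuclideanSpace ℝ (Fin 3))) (a b : ℝ) (ha : 0 ≤ a) (hb : 0 ≤ b)
    (hS : packingDim (proj₂ 0 1 S) + packingDim (proj₂ 0 2 S) ≤ ENNReal.ofReal (a + b)) :
    ∃ S' S'' : Set (EuclideanSpace ℝ (Fin 3)),
      S = S' ∪ S'' ∧
        dimH (proj₁ 0 S') ≤ ENNReal.ofReal a ∧ dimH S'' ≤ ENNReal.ofReal b := by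
  have hsum := ne_top_of_le_ne_top ENNReal.ofReal_ne_top hS
  obtain ⟨hp, hq⟩ := ENNReal.add_ne_top.1 hsum
  lift packingDim (proj₂ 0 1 S) to ℝ≥0 using hp with p hp'
  lift packingDim (proj₂ 0 2 S) to ℝ≥0 using hq with q hq'
  have hpq : (p : ℝ) + q ≤ a + b := by
    have := ENNReal.toReal_mono ENNReal.ofReal_ne_top hS
    rwa [ENNReal.toReal_ofReal (by positivity), ENNReal.toReal_add (by simp) (by simp)] at this
  set ε : ℕ → ℝ≥0 := fun n => 1 / (n + 1) with hε
  have hε0 : ∀ n, 0 < ε n := fun n => by positivity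
  have hdec : ∀ n, ∃ S' S'' : Set (EuclideanSpace ℝ (Fin 3)), S = S' ∪ S'' ∧
      dimH (proj₁ 0 S') ≤ ENNReal.ofReal (a + ε n) ∧ dimH S'' ≤ ENNReal.ofReal b := by
    intro n
    refine exists_decomposition_of_packingDim_lt (p := p + ε n / 2) (q := q + ε n / 2)
      (by positivity) hb ?_ ?_ ?_
    · push_cast
      linarith
    · rw [← hp', ENNReal.coe_lt_coe]
      exact lt_add_of_pos_right _ (half_pos (hε0 n))
    · rw [← hq', ENNReal.coe_lt_coe]
      exact lt_add_of_pos_right _ (half_pos (hε0 n))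
  choose S' S'' hSS ha' hb' using hdec
  -- The loss `ε n` was charged to `a` alone: intersecting the `S' n` sends it to 0, while the union
  -- of the `S'' n` keeps the exact bound `b`.
  refine ⟨S ∩ ⋂ n, S' n, ⋃ n, S'' n, ?_, ?_, ?_⟩
  · refine Subset.antisymm (fun x hx => ?_)
      (union_subset inter_subset_left (iUnion_subset fun n => ?_))
    · by_cases h : ∃ n, x ∈ S'' n
      · exact Or.inr (mem_iUnion.2 h)
      · refine Or.inl ⟨hx, mem_iInter.2 fun n => ?_⟩
        have := hx
        rw [hSS n] at this
        exact this.resolve_right fun h' => h ⟨n, h'⟩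
    · rw [hSS n]
      exact subset_union_right
  · have hlim : Tendsto (fun n => ENNReal.ofReal (a + ε n)) atTop (𝓝 (ENNReal.ofReal a)) := by
      have h : Tendsto (fun n : ℕ => a + 1 / ((n : ℝ) + 1)) atTop (𝓝 (a + 0)) :=
        tendsto_one_div_add_atTop_nhds_zero_nat.const_add a
      rw [add_zero] at h
      simpa [hε] using ENNReal.tendsto_ofReal h
    refine ge_of_tendsto' hlim fun n => (dimH_mono ?_).trans (ha' n)
    exact image_mono fun x hx => mem_iInter.1 hx.2 n
  · rw [dimH_iUnion]
    exact iSup_le hb'
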